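/- Let $p$ be a prime, let $r\ge 1$, and let $e_1,\dots,e_r\in(\mathbb Z/p)^{p-1}$ be linearly independent vectors over $\mathbb Z/p$, with coordinates $e_i=(e_{i,0},\dots,e_{i,p-2})$. Let $X=\mathbb Z/p$, $G=(\mathbb Z/p)^r$ with standard basis $v_1,\dots,v_r$, and $H=\mathbb Z/p$. For $0\le k\le p-2$ let $\Phi(k)\colon G\to H$ be the homomorphism with $\Phi(k)(v_i)=e_{i,k}$ for all $i$, and let $\Phi(p-1)$ be the identity automorphism of $G$. Let $H$ and $G$ act on the set $X^*$ of finite words over $X$ by fixing the empty word and by $$h(xw)=(h+x)\,w,\qquad g(xw)=x\,\bigl(\Phi(x)(g)\bigr)(w)\qquad(h\in H,\ g\in G,\ x\in X,\ w\in X^*),$$ where $\Phi(x)(g)$ is an element of $G$ if $x=p-1$ and of $H$ otherwise. The \emph{multi-edge spinal group} $\mathfrak G$ of $e_1,\dots,e_r$ is the group of permutations of $X^*$ generated by these permutations. It is self-similar: for $g\in\mathfrak G$ and $x\in X$ there are unique $g(x)\in X$ and $g|_x\in\mathfrak G$ with $g(xw)=g(x)\,g|_x(w)$ for all $w\in X^*$.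 For a field $K$, the \emph{Nekrashevych algebra} $N_K(\mathfrak G)$ is the unital associative $*$-algebra over $K$ (with $K$-linear involution) generated by the set $X\sqcup\mathfrak G$ subject to the relations: $g^*=g^{-1}$, the product $g\cdot h$ of generators equals the generator $gh$, and the identity element of $\mathfrak G$ equals the unit $1$ (for $g,h\in\mathfrak G$); $g\,x=g(x)\,g|_x$ (for $g\in\mathfrak G$, $x\in X$); $y^*x=\delta_{x,y}$ (for $x,y\in X$); and $\sum_{x\in X}xx^*=1$. Then: 1. if $r=1$, then $N_K(\mathfrak G)$ is a simple ring for every field $K$; 2. if $r\ge 2$, then $N_K(\mathfrak G)$ is not simple for any field $K$. -/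

import Mathlib

/-! ### Self-similar groups -/

/-- A self-similar group over the alphabet `X`: a group of length-preserving permutations of the set
`List X` of words (equivalently, a group with a faithful action on words by length-preserving
permutations) such that for all `g` in the group and `x ∈ X` there are a letter `g(x)` and an
element `g|_x` of the group with `g(xw) = g(x) g|_x(w)` for all words `w`. -/
structure SelfSimilarGroup (X : Type*) where
  carrier : Subgroup (Equiv.Perm (List X))
  length_apply : ∀ g ∈ carrier, ∀ w : List X, (g w).length = w.length
  exists_section : ∀ g ∈ carrier, ∀ x : X, ∃ y : X, ∃ h ∈ carrier,
    ∀ w : List X, g (x :: w) = y :: h w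

namespace SelfSimilarGroup

theorem perm_apply_inv {α : Type*} (a : Equiv.Perm α) (w : α) : a (a⁻¹ w) = w :=
  a.apply_symm_apply w

/-- The letter `g(x)`. -/
noncomputable def letter {X : Type*} (S : SelfSimilarGroup X) (g : S.carrier) (x : X) : X :=
  (S.exists_section g g.2 x).choose

/-- The section `g|_x`. -/
noncomputable def sect {X : Type*} (S : SelfSimilarGroup X) (g : S.carrier) (x : X) : S.carrier :=
  ⟨(S.exists_section g g.2 x).choose_spec.choose,
    (S.exists_section g g.2 x).choose_spec.choose_spec.1⟩

/-- The defining property of the letter `g(x)` and the section `g|_x`, which determines both. -/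
theorem apply_cons {X : Type*} (S : SelfSimilarGroup X) (g : S.carrier) (x : X) (w : List X) :
    (g : Equiv.Perm (List X)) (x :: w)
      = S.letter g x :: (S.sect g x : Equiv.Perm (List X)) w :=
  (S.exists_section g g.2 x).choose_spec.choose_spec.2 w

/-- The group generated by a set `A` of length-preserving permutations of words that is closed under
taking sections (an automaton) is self-similar. -/
def ofAutomaton {X : Type*} (A : Set (Equiv.Perm (List X)))
    (hlen : ∀ a ∈ A, ∀ w : List X, (a w).length = w.length)
    (hsec : ∀ a ∈ A, ∀ x : X, ∃ y : X, ∃ b ∈ A, ∀ w : List X, a (x :: w) = y :: b w) :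
    SelfSimilarGroup X where
  carrier := Subgroup.closure A
  length_apply := by
    intro g hg
    induction hg using Subgroup.closure_induction with
    | mem a ha => exact hlen a ha
    | one => intro w; rfl
    | mul a b _ _ iha ihb => intro w; rw [Equiv.Perm.mul_apply, iha, ihb]
    | inv a _ iha =>
      intro w
      have h := iha (a⁻¹ w)
      rw [perm_apply_inv] at h
      exact h.symm
  exists_section := by
    intro g hg
    have key : (∀ w : List X, (g w).length = w.length) ∧ ∀ x : X, ∃ y : X,
        ∃ h ∈ Subgroup.closure A, ∀ w : List X, g (x :: w) = y :: h w := by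
      induction hg using Subgroup.closure_induction with
      | mem a ha =>
        refine ⟨hlen a ha, fun x => ?_⟩
        obtain ⟨y, b, hb, h⟩ := hsec a ha x
        exact ⟨y, b, Subgroup.subset_closure hb, h⟩
      | one => exact ⟨fun w => rfl, fun x => ⟨x, 1, one_mem _, fun w => rfl⟩⟩
      | mul a b _ _ iha ihb =>
        refine ⟨fun w => by rw [Equiv.Perm.mul_apply, iha.1, ihb.1], fun x => ?_⟩
        obtain ⟨y, b', hb', hb⟩ := ihb.2 x
        obtain ⟨z, a', ha', ha⟩ := iha.2 y
        exact ⟨z, a' * b', mul_mem ha' hb', fun w => by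
          rw [Equiv.Perm.mul_apply, hb, ha, Equiv.Perm.mul_apply]⟩
      | inv a _ iha =>
        have hl : ∀ w : List X, (a⁻¹ w).length = w.length := by
          intro w
          have h := iha.1 (a⁻¹ w)
          rw [perm_apply_inv] at h
          exact h.symm
        refine ⟨hl, fun x => ?_⟩
        obtain ⟨z, hz⟩ := List.length_eq_one_iff.1 (hl [x])
        obtain ⟨y, b, hb, h⟩ := iha.2 z
        have hx : x = y := by
          have h1 := h []
          rw [← hz, perm_apply_inv] at h1
          exact (List.cons.inj h1).1
        subst hx
        refine ⟨z, b⁻¹, inv_mem hb, fun w => ?_⟩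
        rw [Equiv.Perm.inv_eq_iff_eq, h, perm_apply_inv]
    exact key.2

end SelfSimilarGroup

/-! ### Nekrashevych algebras -/

/-- Generators of the Nekrashevych algebra: `x` and `x*` for the letters `x`, and the group elements
`g` (the generator `g*` is `g⁻¹`). -/
inductive NekrashevychGen {X : Type*} (S : SelfSimilarGroup X)
  | letter (x : X)
  | letterStar (x : X)
  | elt (g : S.carrier)

open NekrashevychGen FreeAlgebra in
/-- Defining relations of the Nekrashevych algebra as a unital algebra. The set of relations is
closed under the involution with `x ↦ x*` and `g ↦ g⁻¹`. -/
inductive NekrashevychRel (K : Type*) [Field K] {X : Type*} [Fintype X] (S : SelfSimilarGroup X) :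
    FreeAlgebra K (NekrashevychGen S) → FreeAlgebra K (NekrashevychGen S) → Prop
  | one : NekrashevychRel K S (ι K (elt 1)) 1
  | mul (g h : S.carrier) :
      NekrashevychRel K S (ι K (elt g) * ι K (elt h)) (ι K (elt (g * h)))
  | ss (g : S.carrier) (x : X) :
      NekrashevychRel K S (ι K (elt g) * ι K (letter x))
        (ι K (letter (S.letter g x)) * ι K (elt (S.sect g x)))
  | ss_star (g : S.carrier) (x : X) :
      NekrashevychRel K S (ι K (letterStar x) * ι K (elt g⁻¹))
        (ι K (elt (S.sect g x)⁻¹) * ι K (letterStar (S.letter g x)))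
  | ck1_same (x : X) :
      NekrashevychRel K S (ι K (letterStar x) * ι K (letter x)) 1
  | ck1_ne (x y : X) (h : x ≠ y) :
      NekrashevychRel K S (ι K (letterStar y) * ι K (letter x)) 0
  | ck2 :
      NekrashevychRel K S (∑ x : X, ι K (letter x) * ι K (letterStar x)) 1

/-- The Nekrashevych algebra of a self-similar group over a finite alphabet, with coefficients in the
field `K`. -/
abbrev NekrashevychAlgebra (K : Type*) [Field K] {X : Type*} [Fintype X]
    (S : SelfSimilarGroup X) : Type _ :=
  RingQuot (NekrashevychRel K S)

/-! ### Multispinal groups -/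

/-- The data defining a multispinal group over the alphabet `X`: a free action of `H` on `X` and a map
`Φ : X → Aut(G) ∪ Hom(G, H)` (disjoint union) satisfying the conditions (S1), (S2), (S3). -/
structure MultispinalData (G H X : Type*) [Group G] [Finite G] [Group H] [Finite H] [Finite X]
    [MulAction H X] where
  Φ : X → MulAut G ⊕ (G →* H)
  free : ∀ (h : H) (x : X), h • x = x → h = 1
  exists_aut : ∃ x α, Φ x = Sum.inl α
  exists_hom : ∃ x l, Φ x = Sum.inr l
  /-- The kernels of the homomorphisms `l ∘ α`, with `l` a homomorphism in the image of `Φ` and `α` in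
  the group generated by the automorphisms in the image of `Φ`, intersect trivially. -/
  separates : ∀ g : G,
    (∀ (l : G →* H) (α : MulAut G), Sum.inr l ∈ Set.range Φ →
      α ∈ Subgroup.closure {β : MulAut G | Sum.inl β ∈ Set.range Φ} → l (α g) = 1) → g = 1

namespace MultispinalData

section

variable {H X : Type*} [Group H] [MulAction H X]

/-- The action of a state `h ∈ H` on words: `h(xw) = h(x) w`. -/
def actH (h : H) : List X → List X
  | [] => []
  | x :: w => (h • x) :: w

theorem actH_one (w : List X) : actH (1 : H) w = w := by
  cases w <;> simp [actH]

theorem actH_mul (h k : H) (w : List X) : actH (h * k) w = actH h (actH k w) := by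
  cases w <;> simp [actH, mul_smul]

theorem length_actH (h : H) (w : List X) : (actH h w).length = w.length := by
  cases w <;> simp [actH]

/-- The state `h ∈ H` as a permutation of words. -/
def permH (h : H) : Equiv.Perm (List X) where
  toFun := actH h
  invFun := actH h⁻¹
  left_inv w := by rw [← actH_mul, inv_mul_cancel, actH_one]
  right_inv w := by rw [← actH_mul, mul_inv_cancel, actH_one]

end

section

variable {G H X : Type*} [Group G] [Finite G] [Group H] [Finite H] [Finite X] [MulAction H X]

/-- The action of a state `g ∈ G` on words: `g(xw) = x Φ(x)(g)(w)`. -/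
def actG (D : MultispinalData G H X) : G → List X → List X
  | _, [] => []
  | g, x :: w => x :: (match D.Φ x with
      | Sum.inl α => D.actG (α g) w
      | Sum.inr l => actH (l g) w)

theorem actG_one (D : MultispinalData G H X) (w : List X) : D.actG 1 w = w := by
  induction w with
  | nil => simp [actG]
  | cons x w ih => cases hx : D.Φ x <;> simp [actG, hx, ih, actH_one]

theorem actG_mul (D : MultispinalData G H X) (g k : G) (w : List X) :
    D.actG (g * k) w = D.actG g (D.actG k w) := by
  induction w generalizing g k with
  | nil => simp [actG]
  | cons x w ih => cases hx : D.Φ x <;> simp [actG, hx, ih, actH_mul]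

theorem length_actG (D : MultispinalData G H X) (g : G) (w : List X) :
    (D.actG g w).length = w.length := by
  induction w generalizing g with
  | nil => simp [actG]
  | cons x w ih => cases hx : D.Φ x <;> simp [actG, hx, ih, length_actH]

/-- The state `g ∈ G` as a permutation of words. -/
def permG (D : MultispinalData G H X) (g : G) : Equiv.Perm (List X) where
  toFun := D.actG g
  invFun := D.actG g⁻¹
  left_inv w := by rw [← actG_mul, inv_mul_cancel, actG_one]
  right_inv w := by rw [← actG_mul, mul_inv_cancel, actG_one]

/-- The multispinal group: the self-similar group generated by the states `g ∈ G` and `h ∈ H`. -/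
def group (D : MultispinalData G H X) : SelfSimilarGroup X :=
  SelfSimilarGroup.ofAutomaton (Set.range D.permG ∪ Set.range (permH (H := H)))
    (by
      rintro _ (⟨g, rfl⟩ | ⟨h, rfl⟩) w
      · exact D.length_actG g w
      · exact length_actH h w)
    (by
      rintro _ (⟨g, rfl⟩ | ⟨h, rfl⟩) x
      · cases hx : D.Φ x with
        | inl α =>
          exact ⟨x, D.permG (α g), Or.inl ⟨_, rfl⟩, fun w => by simp [permG, actG, hx]⟩
        | inr l =>
          exact ⟨x, permH (l g), Or.inr ⟨_, rfl⟩, fun w => by simp [permG, permH, actG, hx]⟩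
      · exact ⟨h • x, permH 1, Or.inr ⟨_, rfl⟩, fun w =>
          congrArg (List.cons (h • x)) (actH_one (H := H) w).symm⟩)

end

end MultispinalData

/-! ### Multi-edge spinal groups -/

/-- The homomorphism `(ℤ/p)^r → ℤ/p` that sends the `i`-th standard basis vector to the `k`-th
coordinate of `e i`. -/
def multiEdgeHom {p r : ℕ} (e : Fin r → Fin (p - 1) → ZMod p) (k : Fin (p - 1)) :
    Multiplicative (Fin r → ZMod p) →* Multiplicative (ZMod p) :=
  AddMonoidHom.toMultiplicative
    { toFun := fun v => ∑ i, v i * e i k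
      map_zero' := by simp
      map_add' := fun v w => by simp [add_mul, Finset.sum_add_distrib] }

/-- The multispinal data of a multi-edge spinal group: `X = ℤ/p`, `G = (ℤ/p)^r`, `H = ℤ/p` acting on
`X` by translations, `Φ(p-1)` is the identity automorphism of `G`, and `Φ(k) : G → H` for
`0 ≤ k ≤ p-2` sends the `i`-th standard basis vector to the `k`-th coordinate of `e i`. -/
def multiEdgeData {p r : ℕ} [Fact p.Prime] (e : Fin r → Fin (p - 1) → ZMod p)
    (he : LinearIndependent (ZMod p) e) :
    MultispinalData (Multiplicative (Fin r → ZMod p)) (Multiplicative (ZMod p)) (ZMod p) where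
  Φ x := if h : x.val < p - 1 then Sum.inr (multiEdgeHom e ⟨x.val, h⟩) else Sum.inl 1
  free h x hx := by
    have h1 : h.toAdd + x = x := hx
    exact Multiplicative.toAdd.injective (by simpa using h1)
  exists_aut := by
    have hp := (Fact.out : p.Prime).two_le
    refine ⟨((p - 1 : ℕ) : ZMod p), 1, dif_neg ?_⟩
    rw [ZMod.val_natCast, Nat.mod_eq_of_lt (by omega)]
    exact lt_irrefl _
  exists_hom := by
    have hp := (Fact.out : p.Prime).two_le
    exact ⟨0, _, dif_pos (by rw [ZMod.val_zero]; omega)⟩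
  separates g hg := by
    have hp := (Fact.out : p.Prime).two_le
    have key : ∑ i, g.toAdd i • e i = 0 := by
      funext k
      have hk : ((k : ℕ) : ZMod p).val = k := by
        rw [ZMod.val_natCast, Nat.mod_eq_of_lt (by omega)]
      have h1 := hg (multiEdgeHom e k) 1
        ⟨((k : ℕ) : ZMod p), by simp [hk]⟩ (one_mem _)
      have h2 : ∑ i, g.toAdd i * e i k = 0 := h1
      simpa [Finset.sum_apply] using h2
    apply Multiplicative.toAdd.injective
    funext i
    exact Fintype.linearIndependent_iff.1 he _ key i

/-- The multi-edge spinal group of the linearly independent vectors `e 0, …, e (r - 1)`. -/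
def multiEdgeSpinalGroup {p r : ℕ} [Fact p.Prime] (e : Fin r → Fin (p - 1) → ZMod p)
    (he : LinearIndependent (ZMod p) e) : SelfSimilarGroup (ZMod p) :=
  (multiEdgeData e he).group

/-!
Multiplying an element of the Nekrashevych algebra by a long word brings it into the span of the
products `u s` of a word `u` and an element `s` of the nucleus. If `v` is a word at which all
elements of the nucleus have trivial section, then `u s v` is the word `u s(v)`, and a nonzero
linear combination of words generates the unit ideal. So a proper ideal can only come from a
nonzero combination of elements of the nucleus that all such words `v` kill. For a multispinal group
these are the elements of `K[G]` that all homomorphisms `l ∘ α` of (S3) map to zero in `K[H]`.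

Conversely, such an element of `K[G]` kills all words, hence lies in the kernel of the action of the
algebra on functions on words modulo functions of finite support. It is nonzero in the algebra,
because it acts nontrivially on functions of pairs of a word and a group element, where `g` acts on
the second component through its section at the word.

For a multi-edge spinal group the homomorphisms `l ∘ α` are the `p - 1` homomorphisms
`(ℤ/p)^r → ℤ/p`. When `r = 1` one of them is injective, and when `r ≥ 2` the dimension count
`(p - 1) p < p ^ r` provides a nonzero element in the common kernel.
-/

namespace SelfSimilarGroup

open Filter

variable {X : Type*} (S : SelfSimilarGroup X)

section Sections

@[simp]
theorem smul_nil (g : S.carrier) : g • ([] : List X) = [] :=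
  List.length_eq_zero_iff.1 (S.length_apply g g.2 [])

theorem smul_cons (g : S.carrier) (x : X) (w : List X) :
    g • (x :: w) = S.letter g x :: S.sect g x • w :=
  S.apply_cons g x w

theorem length_smul (g : S.carrier) (w : List X) : (g • w).length = w.length :=
  S.length_apply g g.2 w

theorem letter_eq_and_sect_eq {g h : S.carrier} {x y : X}
    (H : ∀ w : List X, g • (x :: w) = y :: h • w) : S.letter g x = y ∧ S.sect g x = h := by
  simp only [smul_cons, List.cons.injEq] at H
  exact ⟨(H []).1, FaithfulSMul.eq_of_smul_eq_smul fun w => (H w).2⟩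

@[simp]
theorem sect_one (x : X) : S.sect 1 x = 1 :=
  (S.letter_eq_and_sect_eq (y := x) fun w => by simp only [one_smul]).2

theorem sect_mul (g h : S.carrier) (x : X) :
    S.sect (g * h) x = S.sect g (S.letter h x) * S.sect h x :=
  (S.letter_eq_and_sect_eq (y := S.letter g (S.letter h x)) fun w => by
    simp only [mul_smul, smul_cons]).2

/-- The section `g|_w` of a group element at a word, determined by `g(wu) = g(w) g|_w(u)`. -/
noncomputable def wordSect : S.carrier → List X → S.carrier
  | g, [] => g
  | g, x :: w => wordSect (S.sect g x) w

@[simp]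
theorem wordSect_nil (g : S.carrier) : S.wordSect g [] = g := rfl

@[simp]
theorem wordSect_cons (g : S.carrier) (x : X) (w : List X) :
    S.wordSect g (x :: w) = S.wordSect (S.sect g x) w := rfl

theorem wordSect_append (g : S.carrier) (v w : List X) :
    S.wordSect g (v ++ w) = S.wordSect (S.wordSect g v) w := by
  induction v generalizing g with
  | nil => rfl
  | cons x _ ih => exact ih _

theorem smul_append (g : S.carrier) (v w : List X) :
    g • (v ++ w) = g • v ++ S.wordSect g v • w := by
  induction v generalizing g with
  | nil => simp
  | cons x v ih => simp only [List.cons_append, smul_cons, ih, wordSect_cons]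

@[simp]
theorem wordSect_one (w : List X) : S.wordSect 1 w = 1 := by
  induction w with
  | nil => rfl
  | cons x w ih => rw [wordSect_cons, sect_one, ih]

theorem wordSect_mul (g h : S.carrier) (w : List X) :
    S.wordSect (g * h) w = S.wordSect g (h • w) * S.wordSect h w := by
  induction w generalizing g h with
  | nil => simp
  | cons x w ih => simp only [wordSect_cons, sect_mul, smul_cons, ih]

theorem wordSect_inv (g : S.carrier) (w : List X) :
    S.wordSect g⁻¹ w = (S.wordSect g (g⁻¹ • w))⁻¹ := by
  rw [eq_inv_iff_mul_eq_one, ← mul_eq_one_comm, ← wordSect_mul, mul_inv_cancel, wordSect_one]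

end Sections

section Contraction

theorem forall_of_concat_of_eventually_cofinite {p : List X → Prop}
    (hp : ∀ w, (∀ x, p (w ++ [x])) → p w) (h : ∀ᶠ w in cofinite, p w) (w : List X) : p w := by
  by_contra hw
  obtain ⟨v, hv, hmax⟩ := Set.exists_max_image {w | ¬ p w} List.length (eventually_cofinite.1 h)
    ⟨w, hw⟩
  refine hv (hp v fun x => ?_)
  by_contra hx
  have := hmax _ hx
  simp only [List.length_append, List.length_singleton] at this
  omega

variable {S} [Finite X]

theorem eventually_cofinite_of_concat {p : List X → Prop}
    (h : ∀ᶠ w in cofinite, ∀ x, p (w ++ [x])) : ∀ᶠ w in cofinite, p w := by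
  rw [eventually_cofinite] at h ⊢
  refine ((h.image2 (fun w x => w ++ [x]) Set.finite_univ).insert []).subset fun w hw => ?_
  obtain rfl | ⟨v, x, rfl⟩ := w.eq_nil_or_concat'
  · exact Set.mem_insert _ _
  · exact Or.inr ⟨v, fun hv => hw (hv x), x, trivial, rfl⟩

/-- Since `(gh)|_w = g|_{h(w)} h|_w`, long sections of a product are products of two elements of
`N`, and one more letter brings these back into `N`. -/
theorem eventually_wordSect_mem {N : Set S.carrier} (h1 : 1 ∈ N) (hinv : ∀ s ∈ N, s⁻¹ ∈ N)
    (hmul : ∀ s ∈ N, ∀ t ∈ N, ∀ x, S.sect (s * t) x ∈ N) (hgen : Subgroup.closure N = ⊤)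
    (g : S.carrier) : ∀ᶠ w in cofinite, S.wordSect g w ∈ N := by
  have hg : g ∈ Subgroup.closure N := hgen ▸ Subgroup.mem_top g
  induction hg using Subgroup.closure_induction with
  | mem s hs =>
    refine Eventually.of_forall fun w => ?_
    induction w generalizing s with
    | nil => exact hs
    | cons x _ ih => exact ih _ (by simpa only [mul_one] using hmul s hs 1 h1 x)
  | one => exact Eventually.of_forall fun w => by rwa [wordSect_one]
  | mul g h _ _ ihg ihh =>
    refine eventually_cofinite_of_concat ?_
    filter_upwards [(MulAction.injective h).tendsto_cofinite.eventually ihg, ihh] with w hgw hhw x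
    rw [wordSect_append, wordSect_mul]
    exact hmul _ hgw _ hhw x
  | inv g _ ih =>
    filter_upwards [(MulAction.injective g⁻¹).tendsto_cofinite.eventually ih] with w hw
    rw [wordSect_inv]
    exact hinv _ hw

end Contraction

section Generators

variable (K : Type*) [Field K] [Fintype X]

/-- The letter `x` as an element of the Nekrashevych algebra. -/
noncomputable def algLetter (x : X) : NekrashevychAlgebra K S :=
  RingQuot.mkAlgHom K (NekrashevychRel K S) (FreeAlgebra.ι K (.letter x))

/-- The element `x*` of the Nekrashevych algebra. -/
noncomputable def algStar (x : X) : NekrashevychAlgebra K S :=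
  RingQuot.mkAlgHom K (NekrashevychRel K S) (FreeAlgebra.ι K (.letterStar x))

/-- The group elements as elements of the Nekrashevych algebra. -/
noncomputable def algElt : S.carrier →* NekrashevychAlgebra K S where
  toFun g := RingQuot.mkAlgHom K (NekrashevychRel K S) (FreeAlgebra.ι K (.elt g))
  map_one' := by rw [RingQuot.mkAlgHom_rel K .one, map_one]
  map_mul' g h := by rw [← RingQuot.mkAlgHom_rel K (.mul g h), map_mul]

theorem algElt_mul_algLetter (g : S.carrier) (x : X) :
    S.algElt K g * S.algLetter K x = S.algLetter K (S.letter g x) * S.algElt K (S.sect g x) := by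
  have h := RingQuot.mkAlgHom_rel K (NekrashevychRel.ss (K := K) g x)
  rwa [map_mul, map_mul] at h

theorem algStar_mul_algElt (g : S.carrier) (x : X) :
    S.algStar K x * S.algElt K g =
      S.algElt K (S.sect g⁻¹ x)⁻¹ * S.algStar K (S.letter g⁻¹ x) := by
  have h := RingQuot.mkAlgHom_rel K (NekrashevychRel.ss_star (K := K) g⁻¹ x)
  rwa [map_mul, map_mul, inv_inv] at h

theorem algStar_mul_algLetter_same (x : X) : S.algStar K x * S.algLetter K x = 1 := by
  have h := RingQuot.mkAlgHom_rel K (NekrashevychRel.ck1_same (K := K) (S := S) x)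
  rwa [map_mul, map_one] at h

theorem algStar_mul_algLetter_ne {x y : X} (hxy : x ≠ y) :
    S.algStar K y * S.algLetter K x = 0 := by
  have h := RingQuot.mkAlgHom_rel K (NekrashevychRel.ck1_ne (K := K) (S := S) x y hxy)
  rwa [map_mul, map_zero] at h

theorem sum_algLetter_mul_algStar : ∑ x, S.algLetter K x * S.algStar K x = 1 := by
  have h := RingQuot.mkAlgHom_rel K (NekrashevychRel.ck2 (K := K) (S := S))
  simp only [map_sum, map_mul, map_one] at h
  exact h

variable {S K}

theorem submodule_eq_top {P : Submodule K (NekrashevychAlgebra K S)} (h1 : 1 ∈ P)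
    (hletter : ∀ x, ∀ a ∈ P, S.algLetter K x * a ∈ P)
    (hstar : ∀ x, ∀ a ∈ P, S.algStar K x * a ∈ P)
    (helt : ∀ g, ∀ a ∈ P, S.algElt K g * a ∈ P) : P = ⊤ := by
  suffices ∀ b, ∀ a ∈ P, RingQuot.mkAlgHom K (NekrashevychRel K S) b * a ∈ P by
    refine P.eq_top_iff'.2 fun a => ?_
    obtain ⟨b, rfl⟩ := RingQuot.mkAlgHom_surjective K (NekrashevychRel K S) a
    simpa only [mul_one] using this b 1 h1
  intro b
  induction b using FreeAlgebra.induction with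
  | grade0 k =>
    intro a ha
    rw [AlgHom.commutes, ← Algebra.smul_def]
    exact P.smul_mem k ha
  | grade1 s =>
    cases s with
    | letter x => exact hletter x
    | letterStar x => exact hstar x
    | elt g => exact helt g
  | mul b c hb hc =>
    intro a ha
    rw [map_mul, mul_assoc]
    exact hb _ (hc a ha)
  | add b c hb hc =>
    intro a ha
    rw [map_add, add_mul]
    exact P.add_mem (hb a ha) (hc a ha)

end Generators

section Words

variable (K : Type*) [Field K] [Fintype X]

/-- The product of the letters of a word in the Nekrashevych algebra. -/
noncomputable def algWord (u : List X) : NekrashevychAlgebra K S :=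
  (u.map (S.algLetter K)).prod

/-- The image of `algWord` under the involution of the Nekrashevych algebra. -/
noncomputable def algWordStar (u : List X) : NekrashevychAlgebra K S :=
  (u.map (S.algStar K)).reverse.prod

@[simp]
theorem algWord_nil : S.algWord K [] = 1 := rfl

theorem algWord_cons (x : X) (u : List X) :
    S.algWord K (x :: u) = S.algLetter K x * S.algWord K u := List.prod_cons

theorem algWord_append (u v : List X) :
    S.algWord K (u ++ v) = S.algWord K u * S.algWord K v := by
  simp only [algWord, List.map_append, List.prod_append]

@[simp]
theorem algWordStar_nil : S.algWordStar K [] = 1 := rfl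

theorem algWordStar_cons (x : X) (u : List X) :
    S.algWordStar K (x :: u) = S.algWordStar K u * S.algStar K x := by
  simp only [algWordStar, List.map_cons, List.reverse_cons, List.prod_append, List.prod_singleton]

theorem algWordStar_concat (u : List X) (x : X) :
    S.algWordStar K (u ++ [x]) = S.algStar K x * S.algWordStar K u := by
  simp only [algWordStar, List.map_append, List.map_singleton, List.reverse_append,
    List.reverse_singleton, List.prod_append, List.prod_singleton]

theorem algElt_mul_algWord (g : S.carrier) (u : List X) :
    S.algElt K g * S.algWord K u = S.algWord K (g • u) * S.algElt K (S.wordSect g u) := by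
  induction u generalizing g with
  | nil => simp only [algWord_nil, smul_nil, wordSect_nil, mul_one, one_mul]
  | cons x u ih =>
    rw [algWord_cons, ← mul_assoc, algElt_mul_algLetter, mul_assoc, ih, smul_cons, algWord_cons,
      wordSect_cons, mul_assoc]

theorem algWordStar_mul_algWord_same (u : List X) :
    S.algWordStar K u * S.algWord K u = 1 := by
  induction u with
  | nil => rw [algWordStar_nil, algWord_nil, one_mul]
  | cons x u ih =>
    rw [algWordStar_cons, algWord_cons, mul_assoc, ← mul_assoc (S.algStar K x),
      algStar_mul_algLetter_same, one_mul, ih]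

theorem algWordStar_mul_algWord_eq_zero {u w : List X} (hl : u.length ≤ w.length)
    (h : ¬ u <+: w) : S.algWordStar K u * S.algWord K w = 0 := by
  induction u generalizing w with
  | nil => exact absurd ⟨w, rfl⟩ h
  | cons x u ih =>
    cases w with
    | nil => simp at hl
    | cons y w =>
      rw [algWordStar_cons, algWord_cons, mul_assoc, ← mul_assoc (S.algStar K x)]
      by_cases hxy : y = x
      · subst hxy
        rw [algStar_mul_algLetter_same, one_mul]
        exact ih (by simpa using hl) (by simpa using h)
      · rw [algStar_mul_algLetter_ne S K hxy, zero_mul, mul_zero]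

variable {S K}

theorem exists_algStar_mul_algWord_mul_algElt (x : X) (u : List X) (g : S.carrier) :
    S.algStar K x * (S.algWord K u * S.algElt K g) = 0 ∨
    (∃ u', S.algStar K x * (S.algWord K u * S.algElt K g) = S.algWord K u' * S.algElt K g) ∨
    ∃ h y, S.algStar K x * (S.algWord K u * S.algElt K g) = S.algElt K h * S.algStar K y := by
  cases u with
  | nil => exact Or.inr (Or.inr ⟨_, _, by rw [algWord_nil, one_mul, algStar_mul_algElt]⟩)
  | cons y u =>
    rw [algWord_cons, ← mul_assoc, ← mul_assoc]
    by_cases hyx : y = x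
    · subst hyx
      exact Or.inr (Or.inl ⟨u, by rw [algStar_mul_algLetter_same, one_mul]⟩)
    · exact Or.inl (by rw [algStar_mul_algLetter_ne S K hyx, zero_mul, zero_mul])

variable (S K)

theorem span_algWord_mul_algElt_mul_algWordStar :
    Submodule.span K {a | ∃ u g v, S.algWord K u * S.algElt K g * S.algWordStar K v = a} = ⊤ := by
  set P := Submodule.span K {a | ∃ u g v, S.algWord K u * S.algElt K g * S.algWordStar K v = a}
  have mem (u g v) : S.algWord K u * S.algElt K g * S.algWordStar K v ∈ P :=
    Submodule.subset_span ⟨u, g, v, rfl⟩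
  have mul_mem (b) (hb : ∀ u g v, b * (S.algWord K u * S.algElt K g * S.algWordStar K v) ∈ P)
      (a) (ha : a ∈ P) : b * a ∈ P := by
    have hP : P ≤ P.comap (LinearMap.mulLeft K b) := by
      refine Submodule.span_le.2 ?_
      rintro _ ⟨u, g, v, rfl⟩
      exact hb u g v
    exact hP ha
  refine submodule_eq_top ?_ (fun x => mul_mem _ fun u g v => ?_)
    (fun x => mul_mem _ fun u g v => ?_) (fun h => mul_mem _ fun u g v => ?_)
  · simpa only [algWord_nil, map_one, algWordStar_nil, mul_one] using mem [] 1 []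
  · rw [← mul_assoc, ← mul_assoc, ← algWord_cons]
    exact mem (x :: u) g v
  · rw [← mul_assoc]
    obtain h | ⟨u', h⟩ | ⟨g', y, h⟩ := exists_algStar_mul_algWord_mul_algElt (K := K) x u g
    · rw [h, zero_mul]
      exact P.zero_mem
    · rw [h]
      exact mem u' g v
    · rw [h, mul_assoc, ← algWordStar_concat]
      simpa only [algWord_nil, one_mul] using mem [] g' (v ++ [y])
  · rw [← mul_assoc, ← mul_assoc, algElt_mul_algWord, mul_assoc (S.algWord K _), ← map_mul]
    exact mem (h • u) (S.wordSect h u * g) v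

variable {S K}

theorem eq_zero_of_eventually_mul_algWord {a : NekrashevychAlgebra K S}
    (ha : ∀ᶠ w in cofinite, a * S.algWord K w = 0) : a = 0 := by
  have key := forall_of_concat_of_eventually_cofinite (fun w hw => ?_) ha []
  · simpa only [algWord_nil, mul_one] using key
  · rw [← mul_one (a * _), ← sum_algLetter_mul_algStar, Finset.mul_sum]
    refine Finset.sum_eq_zero fun x _ => ?_
    have := hw x
    rw [algWord_append, algWord_cons, algWord_nil, mul_one] at this
    rw [← mul_assoc, mul_assoc a, this, zero_mul]

theorem eventually_mul_algWordStar_mul_algWord_mem_span {N : Set S.carrier} {g : S.carrier}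
    (hg : ∀ᶠ w in cofinite, S.wordSect g w ∈ N) (u v : List X) :
    ∀ᶠ w in cofinite, S.algWord K u * S.algElt K g * S.algWordStar K v * S.algWord K w ∈
      Submodule.span K
        ((fun p : List X × S.carrier => S.algWord K p.1 * S.algElt K p.2) '' {p | p.2 ∈ N}) := by
  have hlong : ∀ᶠ w : List X in cofinite, v.length ≤ w.length := by
    simpa only [eventually_cofinite, not_le] using List.finite_length_lt X v.length
  have hmem : ∀ᶠ w in cofinite, ∀ w', v ++ w' = w → S.wordSect g w' ∈ N := by
    refine ((eventually_cofinite.1 hg).image (v ++ ·)).subset fun w hw => ?_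
    simpa only [Set.mem_compl_iff, Set.mem_ofPred_eq, Set.mem_image, not_forall, exists_prop,
      and_comm] using hw
  filter_upwards [hlong, hmem] with w hvw hw
  by_cases hp : v <+: w
  · obtain ⟨w', rfl⟩ := hp
    refine Submodule.subset_span ⟨(u ++ g • w', S.wordSect g w'), hw w' rfl, ?_⟩
    simp only [algWord_append]
    rw [mul_assoc, mul_assoc _ (S.algWordStar K v), ← mul_assoc (S.algWordStar K v),
      algWordStar_mul_algWord_same, one_mul, mul_assoc, algElt_mul_algWord]
  · rw [mul_assoc, algWordStar_mul_algWord_eq_zero S K hvw hp, mul_zero]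
    exact zero_mem _

theorem eventually_mul_algWord_mem_span {N : Set S.carrier}
    (hN : ∀ g, ∀ᶠ w in cofinite, S.wordSect g w ∈ N) (a : NekrashevychAlgebra K S) :
    ∀ᶠ w in cofinite, a * S.algWord K w ∈ Submodule.span K
      ((fun p : List X × S.carrier => S.algWord K p.1 * S.algElt K p.2) '' {p | p.2 ∈ N}) := by
  have ha : a ∈ Submodule.span K
      {a | ∃ u g v, S.algWord K u * S.algElt K g * S.algWordStar K v = a} :=
    span_algWord_mul_algElt_mul_algWordStar S K ▸ Submodule.mem_top
  induction ha using Submodule.span_induction with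
  | mem a ha =>
    obtain ⟨u, g, v, rfl⟩ := ha
    exact eventually_mul_algWordStar_mul_algWord_mem_span (hN g) u v
  | zero => exact Eventually.of_forall fun w => by rw [zero_mul]; exact zero_mem _
  | add a b _ _ ha hb =>
    filter_upwards [ha, hb] with w ha hb
    rw [add_mul]
    exact add_mem ha hb
  | smul k a _ ha =>
    filter_upwards [ha] with w ha
    rw [smul_mul_assoc]
    exact Submodule.smul_mem _ k ha

theorem not_replicate_concat_prefix_append {α : Type*} {x y : α} (hxy : x ≠ y) {n : ℕ} {t : List α}
    (ht : t ≠ []) (htn : t.length ≤ n) :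
    ¬ List.replicate n x ++ [y] <+: t ++ (List.replicate n x ++ [y]) := by
  intro hp
  have hpos := List.length_pos_iff.2 ht
  obtain ⟨s, hs⟩ := hp
  have h : (List.replicate n x ++ [y] ++ s)[n]? = some y := by simp
  rw [hs, List.getElem?_append_right htn, List.getElem?_append_left (by simp; omega),
    List.getElem?_replicate_of_lt (by omega)] at h
  exact hxy (Option.some.inj h)

/-- If `u` is a shortest word of the combination and `w = x…xy` is long, then `(uw)* v w = 0` for
every other word `v` of the combination. -/
theorem eq_top_of_linearCombination_algWord_mem [Nontrivial X]
    {I : TwoSidedIdeal (NekrashevychAlgebra K S)} {c : List X →₀ K} (hc : c ≠ 0)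
    (hI : Finsupp.linearCombination K (S.algWord K) c ∈ I) : I = ⊤ := by
  obtain ⟨x, y, hxy⟩ := exists_pair_ne X
  obtain ⟨u, hu, hmin⟩ := c.support.exists_min_image List.length (Finsupp.support_nonempty_iff.2 hc)
  set w := List.replicate (c.support.sup List.length) x ++ [y]
  have hne : ∀ v ∈ c.support, v ≠ u → S.algWordStar K (u ++ w) * S.algWord K (v ++ w) = 0 := by
    intro v hv hvu
    refine algWordStar_mul_algWord_eq_zero S K (by simpa using hmin v hv) fun hp => ?_
    obtain ⟨t, rfl⟩ : u <+: v := List.prefix_of_prefix_length_le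
      ((List.prefix_append u w).trans hp) (List.prefix_append v w) (hmin v hv)
    rw [List.append_assoc, List.prefix_append_right_inj] at hp
    have ht : t.length ≤ c.support.sup List.length :=
      le_trans (by simp) (Finset.le_sup (f := List.length) hv)
    exact not_replicate_concat_prefix_append hxy (fun h => hvu (by simp [h])) ht hp
  have hmul : S.algWordStar K (u ++ w) * Finsupp.linearCombination K (S.algWord K) c *
      S.algWord K w = algebraMap K _ (c u) := by
    rw [Finsupp.linearCombination_apply, Finsupp.sum, Finset.mul_sum, Finset.sum_mul,
      Finset.sum_eq_single_of_mem u hu fun v hv hvu => ?_]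
    · rw [mul_smul_comm, smul_mul_assoc, mul_assoc, ← algWord_append, algWordStar_mul_algWord_same,
        Algebra.algebraMap_eq_smul_one]
    · rw [mul_smul_comm, smul_mul_assoc, mul_assoc, ← algWord_append, hne v hv hvu, smul_zero]
  have hk := I.mul_mem_left (algebraMap K _ (c u)⁻¹) _
    (I.mul_mem_right _ (S.algWord K w) (I.mul_mem_left (S.algWordStar K (u ++ w)) _ hI))
  rw [hmul, ← map_mul, inv_mul_cancel₀ (Finsupp.mem_support_iff.1 hu), map_one] at hk
  exact I.one_mem_iff.1 hk

end Words

theorem extend_comp_symm {α α' β β' M : Type*} [Zero M] {σ : β ≃ β'} {τ : α ≃ α'} {i : α → β}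
    {j : α' → β'} (hi : Function.Injective i) (f : α → M) (h : ∀ a, σ (i a) = j (τ a)) :
    Function.extend i f 0 ∘ σ.symm = Function.extend j (f ∘ τ.symm) 0 := by
  have hj_eq : j = σ ∘ i ∘ τ.symm := funext fun a => by simp [h]
  funext b
  obtain ⟨b, rfl⟩ := σ.surjective b
  rw [Function.comp_apply, σ.symm_apply_apply]
  by_cases hb : ∃ a, i a = b
  · obtain ⟨a, rfl⟩ := hb
    have hj : Function.Injective j :=
      hj_eq ▸ σ.injective.comp (hi.comp τ.symm.injective)
    rw [h, hi.extend_apply, hj.extend_apply, Function.comp_apply, τ.symm_apply_apply]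
  · have hb' : ¬∃ a, j a = σ b := fun ⟨a, ha⟩ =>
      hb ⟨τ.symm a, σ.injective (by rw [← ha, hj_eq]; rfl)⟩
    rw [Function.extend_apply' _ _ _ hb, Function.extend_apply' _ _ _ hb']
    rfl

section TwistedAction

variable (Y : Type*) [MulAction S.carrier Y]

/-- The action of the group on pairs of a word and a point of `Y`, in which `g` acts on the second
component of `(w, y)` through the section `g|_w`. -/
noncomputable def twistedPerm : S.carrier →* Equiv.Perm (List X × Y) :=
  MonoidHom.toHomPerm
    { toFun := fun g p => (g • p.1, S.wordSect g p.1 • p.2)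
      map_one' := by
        funext p
        simp only [one_smul, wordSect_one, Function.End.one_def, id_eq]
      map_mul' := fun g h => by
        funext p
        simp only [mul_smul, wordSect_mul]
        rfl }

variable {Y}

theorem twistedPerm_apply (g : S.carrier) (w : List X) (y : Y) :
    S.twistedPerm Y g (w, y) = (g • w, S.wordSect g w • y) := rfl

theorem twistedPerm_map_cons (g : S.carrier) (x : X) (p : List X × Y) :
    S.twistedPerm Y g (p.map (List.cons x) id) =
      (S.twistedPerm Y (S.sect g x) p).map (List.cons (S.letter g x)) id := by
  obtain ⟨w, y⟩ := p
  simp only [Prod.map_apply, id_eq, twistedPerm_apply, smul_cons, wordSect_cons]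

end TwistedAction

section AlmostZero

variable (K X) (Y : Type*) [Field K]

/-- The functions on pairs of a word and a point of `Y` that vanish at all but finitely many
words. -/
def almostZero : Submodule K (List X × Y → K) where
  carrier := {f | ∀ᶠ w in cofinite, ∀ y, f (w, y) = 0}
  zero_mem' := Set.mem_ofPred_eq ▸ Eventually.of_forall fun _ _ => rfl
  add_mem' hf hg := by
    rw [Set.mem_ofPred_eq] at hf hg ⊢
    filter_upwards [hf, hg] with w hf hg y
    rw [Pi.add_apply, hf, hg, add_zero]
  smul_mem' k f hf := by
    rw [Set.mem_ofPred_eq] at hf ⊢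
    filter_upwards [hf] with w hf y
    rw [Pi.smul_apply, hf, smul_zero]

variable {X K Y}

theorem extend_map_cons_apply_cons (x : X) (f : List X × Y → K) (w : List X) (y : Y) :
    Function.extend (Prod.map (List.cons x) id) f 0 (x :: w, y) = f (w, y) :=
  (List.cons_injective.prodMap Function.injective_id).extend_apply f 0 (w, y)

theorem extend_map_cons_apply_cons_of_ne {x z : X} (hxz : x ≠ z) (f : List X × Y → K) (w : List X)
    (y : Y) : Function.extend (Prod.map (List.cons x) id) f 0 (z :: w, y) = 0 :=
  Function.extend_apply' _ _ _ fun ⟨_, h⟩ => hxz (List.cons.inj (congrArg Prod.fst h)).1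

theorem mem_almostZero {f : List X × Y → K} :
    f ∈ almostZero X K Y ↔ ∀ᶠ w in cofinite, ∀ y, f (w, y) = 0 := Iff.rfl

theorem almostZero_ne_top [Nonempty X] [Nonempty Y] : almostZero X K Y ≠ ⊤ := by
  intro h
  have h1 : (1 : List X × Y → K) ∈ almostZero X K Y := h ▸ Submodule.mem_top
  obtain ⟨_, hw⟩ := (mem_almostZero.1 h1).exists
  exact one_ne_zero (hw (Classical.arbitrary Y))

theorem comp_map_cons_mem_almostZero {f : List X × Y → K} (hf : f ∈ almostZero X K Y) (x : X) :
    f ∘ Prod.map (List.cons x) id ∈ almostZero X K Y := by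
  filter_upwards [(List.cons_injective (a := x)).tendsto_cofinite.eventually hf] with w hw y
  exact hw y

theorem extend_map_cons_mem_almostZero {f : List X × Y → K} (hf : f ∈ almostZero X K Y) (x : X) :
    Function.extend (Prod.map (List.cons x) id) f 0 ∈ almostZero X K Y := by
  rw [mem_almostZero, eventually_cofinite] at hf ⊢
  refine (hf.image (List.cons x)).subset fun w hw => ?_
  obtain ⟨y, hy⟩ := not_forall.1 hw
  obtain ⟨⟨v, z⟩, hv⟩ : ∃ p, Prod.map (List.cons x) id p = (w, y) :=
    not_not.1 fun h => hy (Function.extend_apply' _ _ _ h)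
  obtain ⟨rfl, rfl⟩ := Prod.mk.inj hv
  rw [extend_map_cons_apply_cons] at hy
  exact ⟨v, fun h => hy (h _), rfl⟩

theorem comp_twistedPerm_mem_almostZero [MulAction S.carrier Y] {f : List X × Y → K}
    (hf : f ∈ almostZero X K Y) (g : S.carrier) :
    f ∘ S.twistedPerm Y g ∈ almostZero X K Y := by
  filter_upwards [(MulAction.injective g).tendsto_cofinite.eventually hf] with w hw y
  exact hw _

theorem extend_map_cons_comp_twistedPerm_inv [MulAction S.carrier Y] (f : List X × Y → K)
    (g : S.carrier) (x : X) :
    Function.extend (Prod.map (List.cons x) id) f 0 ∘ S.twistedPerm Y g⁻¹ =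
      Function.extend (Prod.map (List.cons (S.letter g x)) id)
        (f ∘ S.twistedPerm Y (S.sect g x)⁻¹) 0 := by
  simp only [map_inv, Equiv.Perm.inv_def]
  exact extend_comp_symm (List.cons_injective.prodMap Function.injective_id) f
    (S.twistedPerm_map_cons g x)

theorem sum_extend_comp_map_cons_sub_mem_almostZero [Fintype X] (f : List X × Y → K) :
    ∑ x, Function.extend (Prod.map (List.cons x) id) (f ∘ Prod.map (List.cons x) id) 0 - f ∈
      almostZero X K Y := by
  refine mem_almostZero.2 ((eventually_cofinite_ne []).mono fun w hw y => ?_)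
  obtain ⟨z, w, rfl⟩ := List.exists_cons_of_ne_nil hw
  rw [Pi.sub_apply, Finset.sum_apply, Finset.sum_eq_single_of_mem z (Finset.mem_univ z)
    fun x _ hxz => extend_map_cons_apply_cons_of_ne hxz _ w y, extend_map_cons_apply_cons]
  exact sub_self _

end AlmostZero

section Representation

variable (K : Type*) [Field K] (Y : Type*) [MulAction S.carrier Y]

/-- The right action of a generator on functions modulo `almostZero`, by precomposition with `g` or
with prepending `x`, and by extension by zero for `x*`. -/
noncomputable def genAction :
    NekrashevychGen S → (Module.End K ((List X × Y → K) ⧸ almostZero X K Y))ᵐᵒᵖ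
  | .letter x => MulOpposite.op <| (almostZero X K Y).mapQ _
      (LinearMap.funLeft K K (Prod.map (List.cons x) id))
      fun _ hf => comp_map_cons_mem_almostZero hf x
  | .letterStar x => MulOpposite.op <| (almostZero X K Y).mapQ _
      (Function.ExtendByZero.linearMap K (Prod.map (List.cons x) id))
      fun _ hf => extend_map_cons_mem_almostZero hf x
  | .elt g => MulOpposite.op <| (almostZero X K Y).mapQ _
      (LinearMap.funLeft K K (S.twistedPerm Y g))
      fun _ hf => S.comp_twistedPerm_mem_almostZero hf g

theorem genAction_letter_mkQ (x : X) (f : List X × Y → K) :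
    (S.genAction K Y (.letter x)).unop ((almostZero X K Y).mkQ f) =
      (almostZero X K Y).mkQ (f ∘ Prod.map (List.cons x) id) := rfl

theorem genAction_letterStar_mkQ (x : X) (f : List X × Y → K) :
    (S.genAction K Y (.letterStar x)).unop ((almostZero X K Y).mkQ f) =
      (almostZero X K Y).mkQ (Function.extend (Prod.map (List.cons x) id) f 0) := rfl

theorem genAction_elt_mkQ (g : S.carrier) (f : List X × Y → K) :
    (S.genAction K Y (.elt g)).unop ((almostZero X K Y).mkQ f) =
      (almostZero X K Y).mkQ (f ∘ S.twistedPerm Y g) := rfl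

theorem lift_genAction_eq_of_rel [Fintype X] {a b : FreeAlgebra K (NekrashevychGen S)}
    (h : NekrashevychRel K S a b) :
    FreeAlgebra.lift K (S.genAction K Y) a = FreeAlgebra.lift K (S.genAction K Y) b := by
  refine MulOpposite.unop_injective
    (Submodule.linearMap_qext _ (LinearMap.ext fun f => ?_))
  cases h <;> simp only [LinearMap.comp_apply, map_mul, map_one, map_zero, map_sum,
    FreeAlgebra.lift_ι_apply, MulOpposite.unop_mul, MulOpposite.unop_one, MulOpposite.unop_zero,
    Module.End.mul_apply, Module.End.one_apply, LinearMap.zero_apply, Finset.unop_sum,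
    LinearMap.sum_apply, genAction_letter_mkQ, genAction_letterStar_mkQ, genAction_elt_mkQ]
  case one | mul => rfl
  case ss g x =>
    refine congrArg _ (funext fun p => ?_)
    simp only [Function.comp_apply, twistedPerm_map_cons]
  case ss_star g x => rw [extend_map_cons_comp_twistedPerm_inv]
  case ck1_same x => exact congrArg _ (funext fun p => extend_map_cons_apply_cons x f p.1 p.2)
  case ck1_ne x y hxy =>
    exact congrArg _ (funext fun p => extend_map_cons_apply_cons_of_ne hxy.symm f p.1 p.2)
  case ck2 =>
    rw [← map_sum, ← sub_eq_zero, ← map_sub, Submodule.mkQ_apply, Submodule.Quotient.mk_eq_zero]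
    exact sum_extend_comp_map_cons_sub_mem_almostZero f

/-- The right action of the Nekrashevych algebra on functions modulo `almostZero`. -/
noncomputable def rightAction [Fintype X] :
    NekrashevychAlgebra K S →ₐ[K] (Module.End K ((List X × Y → K) ⧸ almostZero X K Y))ᵐᵒᵖ :=
  RingQuot.liftAlgHom K
    ⟨FreeAlgebra.lift K (S.genAction K Y), fun _ _ h => S.lift_genAction_eq_of_rel K Y h⟩

theorem rightAction_algElt [Fintype X] (g : S.carrier) :
    S.rightAction K Y (S.algElt K g) = S.genAction K Y (.elt g) :=
  (RingQuot.liftAlgHom_mkAlgHom_apply K _ _ _).trans (FreeAlgebra.lift_ι_apply _ _)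

theorem rightAction_linearCombination_algElt_mkQ [Fintype X] (c : S.carrier →₀ K)
    (f : List X × Y → K) :
    (S.rightAction K Y (Finsupp.linearCombination K (S.algElt K) c)).unop
        ((almostZero X K Y).mkQ f) =
      (almostZero X K Y).mkQ fun p =>
        Finsupp.linearCombination K f (c.mapDomain fun g => S.twistedPerm Y g p) := by
  simp only [Finsupp.linearCombination_mapDomain]
  induction c using Finsupp.induction_linear with
  | zero => simp only [map_zero, MulOpposite.unop_zero, LinearMap.zero_apply]; rfl
  | add c d hc hd =>
    simp only [map_add, MulOpposite.unop_add, LinearMap.add_apply, hc, hd]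
    rfl
  | single g k =>
    simp only [Finsupp.linearCombination_single, map_smul, MulOpposite.unop_smul,
      LinearMap.smul_apply, rightAction_algElt, genAction_elt_mkQ]
    rfl

variable {S K}

variable (S K) in
theorem nontrivial_nekrashevychAlgebra [Fintype X] [Nonempty X] :
    Nontrivial (NekrashevychAlgebra K S) :=
  have := Submodule.Quotient.nontrivial_iff.2
    (almostZero_ne_top (X := X) (K := K) (Y := PUnit.{1}))
  (S.rightAction K PUnit.{1}).toRingHom.domain_nontrivial

theorem linearCombination_algElt_eq_zero_of_eventually [Fintype X] [Nonempty X]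
    [IsSimpleRing (NekrashevychAlgebra K S)] {c : S.carrier →₀ K}
    (hc : ∀ᶠ w : List X in cofinite, c.mapDomain (fun g => g • w) = 0) :
    Finsupp.linearCombination K (S.algElt K) c = 0 := by
  have := Submodule.Quotient.nontrivial_iff.2
    (almostZero_ne_top (X := X) (K := K) (Y := PUnit.{1}))
  refine (map_eq_zero_iff _ (S.rightAction K PUnit.{1}).toRingHom.injective).1 <|
    MulOpposite.unop_injective (Submodule.linearMap_qext _ (LinearMap.ext fun f => ?_))
  refine (S.rightAction_linearCombination_algElt_mkQ K PUnit c f).trans <|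
    (Submodule.Quotient.mk_eq_zero _).2 ?_
  filter_upwards [hc] with w hw y
  change Finsupp.linearCombination K f (c.mapDomain ((fun v => (v, y)) ∘ fun g => g • w)) = 0
  rw [Finsupp.mapDomain_comp, hw, Finsupp.mapDomain_zero, map_zero]

theorem eventually_mapDomain_wordSect_eq_zero [Fintype X] {c : S.carrier →₀ K}
    (hc : Finsupp.linearCombination K (S.algElt K) c = 0) :
    ∀ᶠ w in cofinite, c.mapDomain (fun g => S.wordSect g w) = 0 := by
  classical
  have h := S.rightAction_linearCombination_algElt_mkQ K S.carrier c
    (fun p => if p.2 = 1 then 1 else 0)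
  rw [hc, map_zero, MulOpposite.unop_zero, LinearMap.zero_apply, eq_comm, Submodule.mkQ_apply,
    Submodule.Quotient.mk_eq_zero] at h
  filter_upwards [h] with w hw
  ext k
  have hk : Finsupp.linearCombination K (fun s => if s * k⁻¹ = 1 then (1 : K) else 0)
      (c.mapDomain fun g => S.wordSect g w) = 0 := by
    have h := hw k⁻¹
    rw [Finsupp.linearCombination_mapDomain] at h ⊢
    exact h
  simpa [Finsupp.linearCombination_apply, Finsupp.sum, mul_inv_eq_one] using hk

end Representation

section SimplicityCriterion

variable {K : Type*} [Field K]

theorem mapDomain_append_smul_apply {c : List X × S.carrier →₀ K} {v w : List X}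
    (hvw : w.length = v.length) (u : List X) :
    c.mapDomain (fun p => p.1 ++ p.2 • v) (u ++ w) =
      (c.curry u).mapDomain (fun s => s • v) w := by
  classical
  rw [← Finsupp.coe_curryAddEquiv]
  induction c using Finsupp.induction_linear with
  | zero => simp only [Finsupp.mapDomain_zero, map_zero, Finsupp.zero_apply]
  | add c d hc hd => simp only [Finsupp.mapDomain_add, map_add, Finsupp.add_apply, hc, hd]
  | single p k =>
    obtain ⟨u', s⟩ := p
    rw [Finsupp.mapDomain_single, Finsupp.coe_curryAddEquiv, Finsupp.curry_single]
    have h : u' ++ s • v = u ++ w ↔ u' = u ∧ s • v = w :=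
      ⟨fun h => List.append_inj' h (by rw [length_smul, hvw]), fun h => by rw [h.1, h.2]⟩
    by_cases hu : u' = u
    · subst hu
      simp only [Finsupp.single_eq_same, Finsupp.mapDomain_single, Finsupp.single_apply,
        List.append_cancel_left_eq]
    · rw [Finsupp.single_eq_of_ne' hu, Finsupp.mapDomain_zero, Finsupp.zero_apply,
        Finsupp.single_eq_of_ne' fun e => hu (h.1 e).1]

theorem mapDomain_append_smul_ne_zero {c : List X × S.carrier →₀ K} {u v : List X}
    (h : (c.curry u).mapDomain (fun s => s • v) ≠ 0) :
    c.mapDomain (fun p => p.1 ++ p.2 • v) ≠ 0 := by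
  classical
  obtain ⟨w, hw⟩ := Finsupp.support_nonempty_iff.2 h
  obtain ⟨s, -, rfl⟩ := Finset.mem_image.1 (Finsupp.mapDomain_support hw)
  rw [Finsupp.mem_support_iff, ← S.mapDomain_append_smul_apply (S.length_smul s v)] at hw
  intro h0
  exact hw (by rw [h0, Finsupp.zero_apply])

theorem curry_mem_supported {α β : Type*} {N : Set β} {c : α × β →₀ K}
    (hc : c ∈ Finsupp.supported K K {p : α × β | p.2 ∈ N}) (a : α) :
    c.curry a ∈ Finsupp.supported K K N := by
  rw [Finsupp.mem_supported] at hc ⊢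
  intro b hb
  exact hc (a := (a, b)) (by simpa using hb)

variable {S} [Fintype X]

theorem linearCombination_mul_algWord {N : Set S.carrier} {c : List X × S.carrier →₀ K}
    (hc : c ∈ Finsupp.supported K K {p : List X × S.carrier | p.2 ∈ N}) {v : List X}
    (hv : ∀ s ∈ N, S.wordSect s v = 1) :
    Finsupp.linearCombination K (fun p => S.algWord K p.1 * S.algElt K p.2) c * S.algWord K v =
      Finsupp.linearCombination K (S.algWord K) (c.mapDomain fun p => p.1 ++ p.2 • v) := by
  rw [Finsupp.linearCombination_mapDomain, Finsupp.linearCombination_apply,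
    Finsupp.linearCombination_apply, Finsupp.sum, Finset.sum_mul]
  refine Finset.sum_congr rfl fun p hp => ?_
  rw [smul_mul_assoc, mul_assoc, algElt_mul_algWord, hv p.2 (hc hp), map_one, mul_one,
    ← algWord_append]
  rfl

theorem exists_linearCombination_eq_mul_algWord {N : Set S.carrier}
    (hN : ∀ g, ∀ᶠ w in cofinite, S.wordSect g w ∈ N) {a : NekrashevychAlgebra K S} (ha : a ≠ 0) :
    ∃ (z : List X) (c : List X × S.carrier →₀ K), c ≠ 0 ∧
      c ∈ Finsupp.supported K K {p : List X × S.carrier | p.2 ∈ N} ∧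
      Finsupp.linearCombination K (fun p => S.algWord K p.1 * S.algElt K p.2) c =
        a * S.algWord K z := by
  obtain ⟨z, hz, hspan⟩ :=
    ((not_eventually.1 fun h => ha (eq_zero_of_eventually_mul_algWord h)).and_eventually
      (eventually_mul_algWord_mem_span hN a)).exists
  obtain ⟨c, hcN, hc⟩ := (Finsupp.mem_span_image_iff_linearCombination K).1 hspan
  exact ⟨z, c, fun h0 => hz (by rw [← hc, h0, map_zero]), hcN, hc⟩

theorem isSimpleRing_of_nucleus [Nontrivial X] {N : Set S.carrier}
    (hN : ∀ g, ∀ᶠ w in cofinite, S.wordSect g w ∈ N)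
    (h : ∀ c ∈ Finsupp.supported K K N,
      (∀ v, (∀ s ∈ N, S.wordSect s v = 1) → c.mapDomain (fun s => s • v) = 0) → c = 0) :
    IsSimpleRing (NekrashevychAlgebra K S) := by
  have := S.nontrivial_nekrashevychAlgebra K
  refine ⟨⟨fun I => or_iff_not_imp_left.2 fun hI => ?_⟩⟩
  obtain ⟨a, haI, ha⟩ : ∃ a ∈ I, a ≠ 0 := by
    contrapose! hI
    exact le_bot_iff.1 fun a ha => (TwoSidedIdeal.mem_bot _).2 (hI a ha)
  obtain ⟨z, c, hc0, hcN, hc⟩ := exists_linearCombination_eq_mul_algWord hN ha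
  obtain ⟨u, hu⟩ : ∃ u, c.curry u ≠ 0 := by
    by_contra! h0
    exact hc0 (Finsupp.curryEquiv.injective (Finsupp.ext h0))
  obtain ⟨v, hv, hcv⟩ : ∃ v, (∀ s ∈ N, S.wordSect s v = 1) ∧
      (c.curry u).mapDomain (fun s => s • v) ≠ 0 := by
    by_contra! h0
    exact hu (h _ (curry_mem_supported hcN u) h0)
  refine eq_top_of_linearCombination_algWord_mem (S.mapDomain_append_smul_ne_zero hcv) ?_
  rw [← linearCombination_mul_algWord hcN hv, hc]
  exact I.mul_mem_right _ _ (I.mul_mem_right _ _ haI)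

end SimplicityCriterion

end SelfSimilarGroup

namespace MultispinalData

open Filter

section States

variable {G H X : Type*} [Group G] [Finite G] [Group H] [Finite H] [Finite X] [MulAction H X]
  (D : MultispinalData G H X)

/-- The inclusion of the states `g ∈ G` into the multispinal group. -/
def ofG : G →* D.group.carrier where
  toFun g := ⟨D.permG g, Subgroup.subset_closure (Or.inl ⟨g, rfl⟩)⟩
  map_one' := Subtype.ext (Equiv.ext D.actG_one)
  map_mul' g k := Subtype.ext (Equiv.ext (D.actG_mul g k))

/-- The inclusion of the states `h ∈ H` into the multispinal group. -/
def ofH : H →* D.group.carrier where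
  toFun h := ⟨permH h, Subgroup.subset_closure (Or.inr ⟨h, rfl⟩)⟩
  map_one' := Subtype.ext (Equiv.ext actH_one)
  map_mul' h k := Subtype.ext (Equiv.ext (actH_mul h k))

theorem ofH_smul_cons (h : H) (x : X) (w : List X) : D.ofH h • (x :: w) = (h • x) :: w := rfl

theorem ofG_smul_cons_inl {x : X} {α : MulAut G} (hx : D.Φ x = Sum.inl α) (g : G) (w : List X) :
    D.ofG g • (x :: w) = x :: D.ofG (α g) • w := by
  change D.actG g (x :: w) = x :: D.actG (α g) w
  rw [actG, hx]

theorem ofG_smul_cons_inr {x : X} {l : G →* H} (hx : D.Φ x = Sum.inr l) (g : G) (w : List X) :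
    D.ofG g • (x :: w) = x :: D.ofH (l g) • w := by
  change D.actG g (x :: w) = x :: actH (l g) w
  rw [actG, hx]

theorem sect_ofH (h : H) (x : X) : D.group.sect (D.ofH h) x = 1 :=
  (D.group.letter_eq_and_sect_eq fun w => by rw [ofH_smul_cons, one_smul]).2

theorem sect_ofG_inl {x : X} {α : MulAut G} (hx : D.Φ x = Sum.inl α) (g : G) :
    D.group.sect (D.ofG g) x = D.ofG (α g) :=
  (D.group.letter_eq_and_sect_eq (D.ofG_smul_cons_inl hx g)).2

theorem sect_ofG_inr {x : X} {l : G →* H} (hx : D.Φ x = Sum.inr l) (g : G) :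
    D.group.sect (D.ofG g) x = D.ofH (l g) :=
  (D.group.letter_eq_and_sect_eq (D.ofG_smul_cons_inr hx g)).2

include D in
theorem injective_smul_letter (x : X) : Function.Injective fun h : H => h • x := fun h k hhk =>
  (inv_mul_eq_one.1 (D.free (k⁻¹ * h) x (by rw [mul_smul, inv_smul_eq_iff]; exact hhk))).symm

/-- The nucleus `G ∪ H` of the multispinal group. -/
def nucleus : Set D.group.carrier := Set.range D.ofG ∪ Set.range D.ofH

theorem one_mem_nucleus : 1 ∈ D.nucleus := Or.inl ⟨1, map_one _⟩

theorem inv_mem_nucleus : ∀ s ∈ D.nucleus, s⁻¹ ∈ D.nucleus := by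
  rintro _ (⟨g, rfl⟩ | ⟨h, rfl⟩)
  · exact Or.inl ⟨g⁻¹, map_inv _ g⟩
  · exact Or.inr ⟨h⁻¹, map_inv _ h⟩

theorem sect_ofG_mem_nucleus (g : G) (x : X) : D.group.sect (D.ofG g) x ∈ D.nucleus := by
  cases hx : D.Φ x with
  | inl α => exact Or.inl ⟨α g, (D.sect_ofG_inl hx g).symm⟩
  | inr l => exact Or.inr ⟨l g, (D.sect_ofG_inr hx g).symm⟩

theorem sect_mul_mem_nucleus :
    ∀ s ∈ D.nucleus, ∀ t ∈ D.nucleus, ∀ x, D.group.sect (s * t) x ∈ D.nucleus := by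
  rintro _ (⟨g, rfl⟩ | ⟨h, rfl⟩) _ (⟨g', rfl⟩ | ⟨h', rfl⟩) x
  · rw [← map_mul]
    exact D.sect_ofG_mem_nucleus _ x
  · rw [SelfSimilarGroup.sect_mul, sect_ofH, mul_one]
    exact D.sect_ofG_mem_nucleus _ _
  · rw [SelfSimilarGroup.sect_mul, sect_ofH, one_mul]
    exact D.sect_ofG_mem_nucleus _ _
  · rw [← map_mul, sect_ofH]
    exact D.one_mem_nucleus

theorem closure_nucleus : Subgroup.closure D.nucleus = ⊤ := by
  have h : D.nucleus = Subtype.val ⁻¹' (Set.range D.permG ∪ Set.range (permH (H := H))) := by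
    ext s
    simp only [nucleus, Set.mem_union, Set.mem_range, Set.mem_preimage, Subtype.ext_iff]
    rfl
  rw [h]
  exact Subgroup.closure_closure_coe_preimage

theorem eventually_wordSect_mem_nucleus (g : D.group.carrier) :
    ∀ᶠ w in cofinite, D.group.wordSect g w ∈ D.nucleus :=
  SelfSimilarGroup.eventually_wordSect_mem D.one_mem_nucleus D.inv_mem_nucleus
    D.sect_mul_mem_nucleus D.closure_nucleus g

theorem wordSect_ofH {w : List X} (hw : w ≠ []) (h : H) : D.group.wordSect (D.ofH h) w = 1 := by
  obtain ⟨x, w, rfl⟩ := List.exists_cons_of_ne_nil hw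
  rw [SelfSimilarGroup.wordSect_cons, sect_ofH, SelfSimilarGroup.wordSect_one]

theorem wordSect_pair {x : X} {l : G →* H} (hx : D.Φ x = Sum.inr l) :
    ∀ s ∈ D.nucleus, D.group.wordSect s [x, x] = 1 := by
  rintro _ (⟨g, rfl⟩ | ⟨h, rfl⟩)
  · rw [SelfSimilarGroup.wordSect_cons, D.sect_ofG_inr hx, D.wordSect_ofH (List.cons_ne_nil x [])]
  · exact D.wordSect_ofH (List.cons_ne_nil x [x]) h

/-- The group generated by the automorphisms in the image of `Φ`. -/
def autGroup : Subgroup (MulAut G) := Subgroup.closure {α | Sum.inl α ∈ Set.range D.Φ}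

theorem exists_wordSect_ofG_eq {α : MulAut G} (hα : α ∈ D.autGroup) :
    ∃ u : List X, ∀ g, D.ofG g • u = u ∧ D.group.wordSect (D.ofG g) u = D.ofG (α g) := by
  rw [autGroup, ← Subgroup.mem_toSubmonoid, Subgroup.closure_toSubmonoid_of_finite] at hα
  induction hα using Submonoid.closure_induction with
  | mem α hα =>
    obtain ⟨x, hx⟩ := hα
    exact ⟨[x], fun g => ⟨by rw [D.ofG_smul_cons_inl hx, SelfSimilarGroup.smul_nil],
      D.sect_ofG_inl hx g⟩⟩
  | one => exact ⟨[], fun g => ⟨SelfSimilarGroup.smul_nil _ _, rfl⟩⟩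
  | mul α β _ _ ihα ihβ =>
    obtain ⟨u, hu⟩ := ihα
    obtain ⟨v, hv⟩ := ihβ
    refine ⟨v ++ u, fun g => ⟨?_, ?_⟩⟩
    · rw [SelfSimilarGroup.smul_append, (hv g).1, (hv g).2, (hu _).1]
    · rw [SelfSimilarGroup.wordSect_append, (hv g).2, (hu _).2, MulAut.mul_apply]

theorem exists_ofG_smul_eq {l : G →* H} {α : MulAut G} (hl : Sum.inr l ∈ Set.range D.Φ)
    (hα : α ∈ D.autGroup) :
    ∃ (w : List X) (F : H → List X), Function.Injective F ∧
      (∀ s ∈ D.nucleus, D.group.wordSect s w = 1) ∧ ∀ g, D.ofG g • w = F (l (α g)) := by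
  obtain ⟨x, hx⟩ := hl
  obtain ⟨u, hu⟩ := D.exists_wordSect_ofG_eq hα
  refine ⟨u ++ [x, x], fun h => u ++ [x, h • x], fun h k hhk => ?_, ?_, fun g => ?_⟩
  · exact D.injective_smul_letter x (by simpa using hhk)
  · rintro _ (⟨g, rfl⟩ | ⟨h, rfl⟩)
    · rw [SelfSimilarGroup.wordSect_append, (hu g).2, D.wordSect_pair hx _ (Or.inl ⟨_, rfl⟩)]
    · exact D.wordSect_ofH (by simp) h
  · rw [SelfSimilarGroup.smul_append, (hu g).1, (hu g).2, D.ofG_smul_cons_inr hx, ofH_smul_cons]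

theorem ofG_injective : Function.Injective D.ofG := by
  refine (injective_iff_map_eq_one _).2 fun g hg => D.separates g fun l α hl hα => ?_
  obtain ⟨w, F, hF, -, hw⟩ := D.exists_ofG_smul_eq hl hα
  have h : F (l (α g)) = F (l (α 1)) := by rw [← hw, ← hw, hg, map_one]
  rw [hF h, map_one, map_one]

include D in
theorem nontrivial_alphabet : Nontrivial X := by
  obtain ⟨x, α, hx⟩ := D.exists_aut
  obtain ⟨y, l, hy⟩ := D.exists_hom
  refine ⟨x, y, ?_⟩
  rintro rfl
  exact Sum.inl_ne_inr (hx.symm.trans hy)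

end States

section CommonKernel

variable {G H X : Type*} [Group G] [Finite G] [Group H] [Finite H] [Finite X] [MulAction H X]
  (D : MultispinalData G H X) (K : Type*) [Field K]

/-- The common kernel of the linear maps `K[G] → K[H]` induced by the homomorphisms `l ∘ α` of
condition (S3). -/
noncomputable def commonKernel : Submodule K (G →₀ K) :=
  ⨅ (l : G →* H) (α : MulAut G) (_ : Sum.inr l ∈ Set.range D.Φ) (_ : α ∈ D.autGroup),
    LinearMap.ker (Finsupp.lmapDomain K K fun g => l (α g))

variable {D K}

theorem mem_commonKernel {c : G →₀ K} :
    c ∈ D.commonKernel K ↔ ∀ (l : G →* H) (α : MulAut G), Sum.inr l ∈ Set.range D.Φ →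
      α ∈ D.autGroup → c.mapDomain (fun g => l (α g)) = 0 := by
  simp only [commonKernel, Submodule.mem_iInf, LinearMap.mem_ker, Finsupp.lmapDomain_apply]

theorem mapDomain_mem_commonKernel {c : G →₀ K} (hc : c ∈ D.commonKernel K) {β : MulAut G}
    (hβ : β ∈ D.autGroup) : c.mapDomain β ∈ D.commonKernel K := by
  rw [mem_commonKernel] at hc ⊢
  intro l α hl hα
  rw [← Finsupp.mapDomain_comp]
  exact hc l (α * β) hl (mul_mem hα hβ)

theorem mapDomain_eq_zero_of_mem_commonKernel {c : G →₀ K} (hc : c ∈ D.commonKernel K)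
    {l : G →* H} (hl : Sum.inr l ∈ Set.range D.Φ) : c.mapDomain l = 0 :=
  mem_commonKernel.1 hc l 1 hl (one_mem _)

theorem mapDomain_ofG_smul_eq_zero {c : G →₀ K} (hc : c ∈ D.commonKernel K) (w : List X) :
    c.mapDomain (fun g => D.ofG g • w) = 0 := by
  induction w generalizing c with
  | nil =>
    obtain ⟨x, l, hx⟩ := D.exists_hom
    have h : (fun g => D.ofG g • ([] : List X)) = (fun _ => []) ∘ l := funext fun g => by
      rw [SelfSimilarGroup.smul_nil, Function.comp_apply]
    rw [h, Finsupp.mapDomain_comp, mapDomain_eq_zero_of_mem_commonKernel hc ⟨x, hx⟩,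
      Finsupp.mapDomain_zero]
  | cons x w ih =>
    cases hx : D.Φ x with
    | inl α =>
      have h : (fun g => D.ofG g • (x :: w)) = (List.cons x ∘ fun g => D.ofG g • w) ∘ α :=
        funext fun g => D.ofG_smul_cons_inl hx g w
      rw [h, Finsupp.mapDomain_comp, Finsupp.mapDomain_comp, ih
        (mapDomain_mem_commonKernel hc (Subgroup.subset_closure ⟨x, hx⟩)), Finsupp.mapDomain_zero]
    | inr l =>
      have h : (fun g => D.ofG g • (x :: w)) = (fun h => x :: D.ofH h • w) ∘ l :=
        funext fun g => D.ofG_smul_cons_inr hx g w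
      rw [h, Finsupp.mapDomain_comp, mapDomain_eq_zero_of_mem_commonKernel hc ⟨x, hx⟩,
        Finsupp.mapDomain_zero]

theorem support_subset_range_ofG {c : D.group.carrier →₀ K}
    (hcN : c ∈ Finsupp.supported K K D.nucleus)
    (hc : ∀ v, (∀ s ∈ D.nucleus, D.group.wordSect s v = 1) → c.mapDomain (fun s => s • v) = 0) :
    (c.support : Set D.group.carrier) ⊆ Set.range D.ofG := by
  classical
  intro s hs
  obtain hs' | ⟨h, rfl⟩ := hcN hs
  · exact hs'
  obtain ⟨x, l, hx⟩ := D.exists_hom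
  by_contra hne
  have huniq : ∀ t ∈ D.nucleus, t • [x, x] = D.ofH h • [x, x] → t = D.ofH h := by
    rintro _ (⟨g, rfl⟩ | ⟨k, rfl⟩) e
    · rw [D.ofG_smul_cons_inr hx, ofH_smul_cons] at e
      rw [D.free h x (List.cons.inj e).1.symm, map_one] at hne
      exact absurd ⟨1, map_one _⟩ hne
    · rw [ofH_smul_cons, ofH_smul_cons] at e
      rw [D.injective_smul_letter x (List.cons.inj e).1]
  refine Finsupp.mem_support_iff.1 hs ?_
  calc c (D.ofH h)
      = ∑ t ∈ c.support with t • [x, x] = D.ofH h • [x, x], c t := by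
        refine (Finset.sum_eq_single_of_mem (D.ofH h) (by simpa using hs) fun t ht htne => ?_).symm
        rw [Finset.mem_filter] at ht
        exact absurd (huniq t (hcN ht.1) ht.2) htne
    _ = c.mapDomain (fun s => s • [x, x]) (D.ofH h • [x, x]) :=
        (Finsupp.mapDomain_apply_eq_sum _ c).symm
    _ = 0 := by rw [hc _ (D.wordSect_pair hx), Finsupp.zero_apply]

end CommonKernel

section Simplicity

variable {G H X : Type*} [Group G] [Finite G] [Group H] [Finite H] [Fintype X] [MulAction H X]
  {D : MultispinalData G H X} {K : Type*} [Field K]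

theorem isSimpleRing_of_commonKernel_eq_bot (hD : D.commonKernel K = ⊥) :
    IsSimpleRing (NekrashevychAlgebra K D.group) := by
  have := D.nontrivial_alphabet
  refine SelfSimilarGroup.isSimpleRing_of_nucleus D.eventually_wordSect_mem_nucleus
    fun c hcN hc => ?_
  obtain ⟨c, rfl⟩ : ∃ c₀ : G →₀ K, c₀.mapDomain D.ofG = c :=
    ⟨_, Finsupp.mapDomain_comapDomain _ D.ofG_injective c (support_subset_range_ofG hcN hc)⟩
  suffices c ∈ D.commonKernel K by
    rw [hD, Submodule.mem_bot] at this
    rw [this, Finsupp.mapDomain_zero]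
  refine mem_commonKernel.2 fun l α hl hα => ?_
  obtain ⟨w, F, hF, hw, hwF⟩ := D.exists_ofG_smul_eq hl hα
  have h : (fun s => s • w) ∘ D.ofG = F ∘ fun g => l (α g) := funext hwF
  apply Finsupp.mapDomain_injective hF
  rw [← Finsupp.mapDomain_comp, ← h, Finsupp.mapDomain_comp, hc w hw, Finsupp.mapDomain_zero]

theorem commonKernel_eq_bot_of_isSimpleRing [IsSimpleRing (NekrashevychAlgebra K D.group)] :
    D.commonKernel K = ⊥ := by
  refine (Submodule.eq_bot_iff _).2 fun c hc => ?_
  obtain ⟨x, α, hx⟩ := D.exists_aut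
  have : Nonempty X := ⟨x⟩
  have hsect (n : ℕ) (g : G) :
      D.group.wordSect (D.ofG g) (List.replicate n x) = D.ofG ((α ^ n) g) := by
    induction n generalizing g with
    | zero => rfl
    | succ n ih =>
      rw [List.replicate_succ, SelfSimilarGroup.wordSect_cons, D.sect_ofG_inl hx, ih, pow_succ,
        MulAut.mul_apply]
  have h0 : Finsupp.linearCombination K (D.group.algElt K) (c.mapDomain D.ofG) = 0 :=
    SelfSimilarGroup.linearCombination_algElt_eq_zero_of_eventually <|
      Eventually.of_forall fun w => by
        rw [← Finsupp.mapDomain_comp]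
        exact mapDomain_ofG_smul_eq_zero hc w
  have hinj : Function.Injective fun n => List.replicate n x := fun m n h => by
    simpa using congrArg List.length h
  obtain ⟨n, hn⟩ := (hinj.tendsto_cofinite.eventually
    (SelfSimilarGroup.eventually_mapDomain_wordSect_eq_zero h0)).exists
  have h : (fun s => D.group.wordSect s (List.replicate n x)) ∘ D.ofG = D.ofG ∘ (α ^ n) :=
    funext (hsect n)
  rw [← Finsupp.mapDomain_comp, h] at hn
  exact Finsupp.mapDomain_injective (D.ofG_injective.comp (α ^ n).injective)
    (hn.trans Finsupp.mapDomain_zero.symm)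

theorem isSimpleRing_iff : IsSimpleRing (NekrashevychAlgebra K D.group) ↔ D.commonKernel K = ⊥ :=
  ⟨fun _ => commonKernel_eq_bot_of_isSimpleRing, isSimpleRing_of_commonKernel_eq_bot⟩

end Simplicity

end MultispinalData

theorem exists_ne_zero_forall_mapDomain_eq_zero (K : Type*) [Field K] {ι α β : Type*} [Fintype ι]
    [Fintype α] [Fintype β] (φ : ι → α → β)
    (h : Fintype.card ι * Fintype.card β < Fintype.card α) :
    ∃ c : α →₀ K, c ≠ 0 ∧ ∀ i, c.mapDomain (φ i) = 0 := by
  have hker : LinearMap.ker (LinearMap.pi fun i => Finsupp.lmapDomain K K (φ i)) ≠ ⊥ :=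
    LinearMap.ker_ne_bot_of_finrank_lt (by
      simpa [Module.finrank_pi_fintype, Module.finrank_finsupp_self] using h)
  obtain ⟨c, hc, hc0⟩ := Submodule.exists_mem_ne_zero_of_ne_bot hker
  exact ⟨c, hc0, fun i => congrFun (LinearMap.mem_ker.1 hc) i⟩

section MultiEdge

variable {p r : ℕ} [Fact p.Prime]

theorem multiEdgeHom_injective (e : Fin 1 → Fin (p - 1) → ZMod p) {k : Fin (p - 1)}
    (hk : e 0 k ≠ 0) : Function.Injective (multiEdgeHom e k) := by
  refine (injective_iff_map_eq_one _).2 fun v hv => ?_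
  have h : ∑ i, v.toAdd i * e i k = 0 := hv
  rw [Fin.sum_univ_one, mul_eq_zero, or_iff_left hk] at h
  exact Multiplicative.toAdd.injective (funext fun i => by rw [Subsingleton.elim i 0, h]; rfl)

variable (e : Fin r → Fin (p - 1) → ZMod p) (he : LinearIndependent (ZMod p) e)

theorem inr_mem_range_multiEdgeData_iff {l : Multiplicative (Fin r → ZMod p) →* _} :
    Sum.inr l ∈ Set.range (multiEdgeData e he).Φ ↔ ∃ k, multiEdgeHom e k = l := by
  constructor
  · rintro ⟨x, hx⟩
    simp only [multiEdgeData] at hx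
    split_ifs at hx with h
    exact ⟨_, Sum.inr.inj hx⟩
  · rintro ⟨k, rfl⟩
    have hk : ((k : ℕ) : ZMod p).val = k := by
      rw [ZMod.val_natCast, Nat.mod_eq_of_lt (by omega)]
    exact ⟨(k : ℕ), by simp [multiEdgeData, hk]⟩

theorem autGroup_multiEdgeData : (multiEdgeData e he).autGroup = ⊥ := by
  refine Subgroup.closure_eq_bot_iff.2 ?_
  rintro α ⟨x, hx⟩
  simp only [multiEdgeData] at hx
  split_ifs at hx with h
  exact (Sum.inl.inj hx).symm

theorem isSimpleRing_multiEdgeSpinalGroup_iff (K : Type*) [Field K] :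
    IsSimpleRing (NekrashevychAlgebra K (multiEdgeSpinalGroup e he)) ↔
      ∀ c : Multiplicative (Fin r → ZMod p) →₀ K,
        (∀ k, c.mapDomain (multiEdgeHom e k) = 0) → c = 0 := by
  rw [multiEdgeSpinalGroup, MultispinalData.isSimpleRing_iff, Submodule.eq_bot_iff]
  simp only [MultispinalData.mem_commonKernel, inr_mem_range_multiEdgeData_iff,
    autGroup_multiEdgeData, Subgroup.mem_bot, forall_exists_index]
  refine forall_congr' fun c => imp_congr_left ⟨fun h k => h _ 1 k rfl rfl, ?_⟩
  rintro h _ _ k rfl rfl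
  exact h k

end MultiEdge

theorem mainTheorem8 (p : ℕ) [Fact p.Prime] (r : ℕ) (e : Fin r → Fin (p - 1) → ZMod p)
    (he : LinearIndependent (ZMod p) e) :
    (r = 1 → ∀ (K : Type*) [Field K],
      IsSimpleRing (NekrashevychAlgebra K (multiEdgeSpinalGroup e he))) ∧
    (2 ≤ r → ∀ (K : Type*) [Field K],
      ¬ IsSimpleRing (NekrashevychAlgebra K (multiEdgeSpinalGroup e he))) := by
  constructor
  · rintro rfl K _
    obtain ⟨k, hk⟩ := Function.ne_iff.1 (he.ne_zero 0)
    refine (isSimpleRing_multiEdgeSpinalGroup_iff e he K).2 fun c hc => ?_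
    exact Finsupp.mapDomain_injective (multiEdgeHom_injective e hk)
      ((hc k).trans Finsupp.mapDomain_zero.symm)
  · intro hr K _ hsimple
    have hcard : (p - 1) * p < p ^ r :=
      calc (p - 1) * p < p * p :=
            Nat.mul_lt_mul_of_pos_right (Nat.pred_lt (NeZero.ne p)) (NeZero.pos p)
        _ = p ^ 2 := (sq p).symm
        _ ≤ p ^ r := Nat.pow_le_pow_right (NeZero.pos p) hr
    obtain ⟨c, hc0, hc⟩ := exists_ne_zero_forall_mapDomain_eq_zero K
      (fun k g => multiEdgeHom e k g) (by simpa using hcard)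
    exact hc0 ((isSimpleRing_multiEdgeSpinalGroup_iff e he K).1 hsimple c hc)
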